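/- A metric measure space is a triple $X=(X,d,\mu)$ where $(X,d)$ is a complete separable metric space and $\mu$ is a Borel probability measure on $X$. For an integer $\ell\ge 1$, let $\tau_\ell(X)$ be the law of the random real $\ell\times\ell$ matrix $\bigl(d(\xi_i,\xi_j)\bigr)_{i,j=1}^{\ell}$, where $\xi_1,\dots,\xi_\ell$ are i.i.d. random points of $X$ with distribution $\mu$; that is, $\tau_\ell(X)$ is the push-forward of the product measure $\mu^{\ell}$ under $(x_1,\dots,x_\ell)\mapsto (d(x_i,x_j))_{i,j=1}^{\ell}$. We say that $X_n\to X$ in Gromov's sense if, for every $\ell\ge1$, $\tau_\ell(X_n)\to\tau_\ell(X)$ weakly as $n\to\infty$, as probability measures on $\mathbb R^{\ell\times\ell}$. The Gromov–Prohorov distance $d_{GP}(X,X')$ between metric measure spaces $X=(X,d,\mu)$ and $X'=(X',d',\mu')$ is the infimum of all $\varepsilon>0$ for which there exist a metric space $Z$ and isometric embeddings $\varphi:X\to Z$ and $\varphi':X'\to Z$ such that $d_P(\varphi_*\mu,\varphi'_*\mu')\le\varepsilon$. Here $d_P$ is the Prohorov distance: for Borel probability measures $\alpha,\beta$ on $Z$,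 $d_P(\alpha,\beta)$ is the infimum of all $\varepsilon>0$ such that $\beta(B)\le\alpha(\{z: d_Z(z,B)\le\varepsilon\})+\varepsilon$ for every Borel set $B\subseteq Z$. **Theorem.** Let $(X_n)_{n\ge1}$ and $X$ be metric measure spaces. Then $X_n\to X$ in Gromov's sense if and only if $d_{GP}(X_n,X)\to0$ as $n\to\infty$. -/

import Mathlib

open MeasureTheory Topology Filter

universe u v

section GromovProhorov

/-- The map `ρ_ℓ : X^ℓ → M_ℓ` sending `(x₁, …, x_ℓ)` to the matrix of its mutual distances;
`M_ℓ = ℝ^(ℓ×ℓ)` carries the product topology and σ-algebra. -/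
def distMatrix (X : Type u) [MetricSpace X] (l : ℕ) (x : Fin l → X) :
    Fin l → Fin l → ℝ :=
  fun i j => dist (x i) (x j)

theorem measurable_distMatrix (X : Type u) [MetricSpace X] [TopologicalSpace.SeparableSpace X]
    [MeasurableSpace X] [BorelSpace X] (l : ℕ) : Measurable (distMatrix X l) := by
  have : SecondCountableTopology X := UniformSpace.secondCountable_of_separable X
  refine measurable_pi_lambda _ fun i => measurable_pi_lambda _ fun j => ?_
  exact (measurable_pi_apply i).dist (measurable_pi_apply j)

/-- The measure `τ_ℓ(X, d, μ)`: the push-forward of the product measure `μ^ℓ` along `ρ_ℓ`, i.e.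
the law of the matrix of mutual distances of `ℓ` i.i.d. random points with distribution `μ`. -/
noncomputable def distMatrixLaw {X : Type u} [MetricSpace X] [TopologicalSpace.SeparableSpace X]
    [MeasurableSpace X] [BorelSpace X] (μ : ProbabilityMeasure X) (l : ℕ) :
    ProbabilityMeasure (Fin l → Fin l → ℝ) :=
  (ProbabilityMeasure.pi fun _ : Fin l => μ).map (measurable_distMatrix X l).aemeasurable

/-- `X_n → X` in Gromov's sense: for every `ℓ ≥ 1`, `τ_ℓ(X_n) → τ_ℓ(X)` weakly, as probability
measures on the space of real `ℓ × ℓ` matrices. -/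
def GromovTendsto {X : ℕ → Type u} [∀ n, MetricSpace (X n)]
    [∀ n, TopologicalSpace.SeparableSpace (X n)]
    [∀ n, MeasurableSpace (X n)] [∀ n, BorelSpace (X n)] (μ : ∀ n, ProbabilityMeasure (X n))
    {Y : Type v} [MetricSpace Y] [TopologicalSpace.SeparableSpace Y]
    [MeasurableSpace Y] [BorelSpace Y] (ν : ProbabilityMeasure Y) : Prop :=
  ∀ l : ℕ, 1 ≤ l → Tendsto (fun n => distMatrixLaw (μ n) l) atTop (𝓝 (distMatrixLaw ν l))

/-- The Gromov–Prohorov distance: the infimum of the `ε > 0` for which there are a metric space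
`Z` (with its Borel σ-algebra) and isometric embeddings `φ : X → Z`, `φ' : X' → Z` such that the
Prohorov distance of the push-forwards `φ_* μ` and `φ'_* μ'` is at most `ε`.
The universe of `Z` is no restriction, as `Z` may be replaced by its subspace `φ(X) ∪ φ'(X')`. -/
noncomputable def gromovProhorovDist {X : Type u} [MetricSpace X] [MeasurableSpace X]
    {X' : Type v} [MetricSpace X'] [MeasurableSpace X']
    (μ : ProbabilityMeasure X) (μ' : ProbabilityMeasure X') : ℝ :=
  sInf {ε : ℝ | 0 < ε ∧
    ∃ (Z : Type (max u v)) (_ : MetricSpace Z) (_ : MeasurableSpace Z) (_ : BorelSpace Z)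
      (φ : X → Z) (φ' : X' → Z), Isometry φ ∧ Isometry φ' ∧
        levyProkhorovDist ((μ : Measure X).map φ) ((μ' : Measure X').map φ') ≤ ε}

end GromovProhorov

/-!
The theorem compares two ways of saying that metric measure spaces are close.

Suppose first that `μ n` and `ν` are `ε`-close in a common metric space `Z`. The layer cake formula
bounds the difference of their integrals of a bounded Lipschitz function by a multiple of `ε`, and
exchanging the factors of a product one after the other gives the same for `l`-fold products
(`integral_pi_le_add_of_levyProkhorovEDist_lt`). The distance matrix is a Lipschitz function of the
`l` points, so the laws of the distance matrices converge when tested against bounded Lipschitz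
functions, which is weak convergence. The estimate only involves `ε`, so the space `Z` may vary
with `n`.

Conversely, assume that the distance matrix laws converge. With high `ν`-probability, one of `K + 1`
independent points is `ε`-close to another, if `K` is large. This is an open condition on the
distance matrix, so it has high probability under `μ n` too for large `n`, and consequently `ν` and
`μ n` are covered up to mass `ε` by `K` balls of radius `ε`, with the same `K`
(`exists_lt_measure_iUnion_ball`). Chebyshev's inequality for the `2 ^ K` unions of these balls
yields one sample size `l` for which the empirical measure of `l` independent points is, with
probability at least `3 / 4`, within `2 * ε` of the sampled measure, both for `ν` and for `μ n`
(`pi_levyProkhorovEDist_map_uniformOn_gt_le`). By weak convergence of the laws of `l × l` distance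
matrices there are well-distributed samples of `μ n` and of `ν` whose distance matrices nearly
agree. Gluing the two spaces along these samples brings the empirical measures within `ε` of each
other, and the triangle inequality concludes (`gromovProhorovDist_le_of_samples`).
-/

/-! ### Lipschitz functions and the Lévy–Prokhorov distance -/

open Metric ENNReal NNReal in
/-- A quantitative form of the fact that closeness in the Lévy–Prokhorov distance controls integrals
of Lipschitz functions: in the layer cake formula, the `ε`-thickening of `{t ≤ f}` lies in
`{t ≤ f + K * ε}`. -/
theorem integral_le_add_of_levyProkhorovEDist_lt {Z : Type*} [MeasurableSpace Z]
    [PseudoMetricSpace Z] [OpensMeasurableSpace Z] {α β : Measure Z} [IsProbabilityMeasure α]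
    [IsProbabilityMeasure β] {ε : ℝ} (hε : 0 < ε)
    (h : levyProkhorovEDist α β < ENNReal.ofReal ε) {f : Z → ℝ} {K : ℝ≥0} {M : ℝ}
    (hf : LipschitzWith K f) (f0 : ∀ z, 0 ≤ f z) (fM : ∀ z, f z ≤ M) :
    ∫ z, f z ∂α ≤ ∫ z, f z ∂β + (K + M) * ε := by
  have : Nonempty Z := α.nonempty_of_neZero
  have hM : 0 ≤ M := (f0 (Classical.arbitrary Z)).trans (fM _)
  let F : BoundedContinuousFunction Z ℝ := BoundedContinuousFunction.ofNormedAddCommGroup f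
    hf.continuous M fun z => by rw [Real.norm_of_nonneg (f0 z)]; exact fM z
  have hFM : ‖F‖ ≤ M := BoundedContinuousFunction.norm_ofNormedAddCommGroup_le _ hM _
  have hFle : ∀ z, f z ≤ ‖F‖ := fun z => F.apply_le_norm z
  have hKε : 0 ≤ (K : ℝ) * ε := by positivity
  have key := F.integral_le_of_levyProkhorovEDist_lt α β hε h (Eventually.of_forall f0)
  have hint : Integrable f β := F.integrable β
  have hlayer : ∫ z, (f z + K * ε) ∂β
      = ∫ t in Set.Ioc 0 (‖F‖ + K * ε), β.real {z | t ≤ f z + K * ε} :=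
    Integrable.integral_eq_integral_Ioc_meas_le (hint.add (integrable_const _))
      (Eventually.of_forall fun z => add_nonneg (f0 z) hKε)
      (Eventually.of_forall fun z => by simpa using hFle z)
  have hanti : ∀ s : ℝ → Set Z, Antitone s → ∀ a b : ℝ,
      IntegrableOn (fun t => β.real (s t)) (Set.Ioc a b) := fun s hs a b => by
    refine Measure.integrableOn_of_bounded (M := 1) measure_Ioc_lt_top.ne ?_ ?_
    · exact (Antitone.measurable fun _ _ hst =>
        measureReal_mono (hs hst)).aestronglyMeasurable
    · refine Eventually.of_forall fun t => ?_
      rw [Real.norm_of_nonneg measureReal_nonneg]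
      exact measureReal_le_one
  have hmono : ∫ t in Set.Ioc 0 ‖F‖, β.real (thickening ε {a | t ≤ F a})
      ≤ ∫ t in Set.Ioc 0 (‖F‖ + K * ε), β.real {z | t ≤ f z + K * ε} := by
    have i1 := hanti (fun t => thickening ε {a | t ≤ F a}) (fun _ _ hst =>
      thickening_subset_of_subset ε fun _ h => le_trans hst h)
    have i2 := hanti (fun t => {z | t ≤ f z + K * ε}) (fun _ _ hst _ h => le_trans hst h)
    refine (setIntegral_mono (i1 _ _) (i2 _ _) fun t => ?_).trans
      (setIntegral_mono_set (i2 _ _) (Eventually.of_forall fun t => measureReal_nonneg)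
        (Set.Ioc_subset_Ioc_right (by linarith)).eventuallyLE)
    refine measureReal_mono fun z hz => ?_
    obtain ⟨a, ha, hza⟩ := mem_thickening_iff.1 hz
    have h1 : t ≤ f a := ha
    have h2 : f a ≤ f z + K * dist a z := by
      have := (le_abs_self _).trans (hf.dist_le_mul a z)
      linarith
    have h3 : (K : ℝ) * dist a z ≤ K * ε := by
      rw [dist_comm]; gcongr
    show t ≤ f z + K * ε
    linarith
  rw [← hlayer, integral_add hint (integrable_const _), integral_const] at hmono
  have h4 : ε * ‖F‖ ≤ ε * M := by gcongr
  simp only [probReal_univ, one_smul] at hmono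
  have h5 : ∫ z, F z ∂α = ∫ z, f z ∂α := rfl
  linarith

theorem integral_pi_succ {Z : Type*} [MeasurableSpace Z] (α : Measure Z) [IsProbabilityMeasure α]
    (l : ℕ) {F : (Fin (l + 1) → Z) → ℝ} (hF : Integrable F (Measure.pi fun _ => α)) :
    ∫ x, F x ∂(Measure.pi fun _ => α)
      = ∫ z, ∫ w, F (Fin.cons z w) ∂(Measure.pi fun _ : Fin l => α) ∂α := by
  have hp := (measurePreserving_piFinSuccAbove (fun _ : Fin (l + 1) => α) 0).symm
  rw [← hp.integral_comp (MeasurableEquiv.measurableEmbedding _), integral_prod]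
  · simp [MeasurableEquiv.piFinSuccAbove, Fin.insertNthEquiv, Fin.insertNth_zero']
  · exact hp.integrable_comp_of_integrable hF

open NNReal in
/-- The analogue for product measures of `integral_le_add_of_levyProkhorovEDist_lt`. The factors
are exchanged one at a time, by Fubini: `z ↦ ∫ F (z, w) ∂β^l` satisfies the same bounds as `F`.
This makes a coupling of `α` and `β` unnecessary. -/
theorem integral_pi_le_add_of_levyProkhorovEDist_lt {Z : Type*} [MeasurableSpace Z]
    [PseudoMetricSpace Z] [SecondCountableTopology Z] [OpensMeasurableSpace Z]
    {α β : Measure Z} [IsProbabilityMeasure α] [IsProbabilityMeasure β] {ε : ℝ} (hε : 0 < ε)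
    (h : levyProkhorovEDist α β < ENNReal.ofReal ε) {K : ℝ≥0} {M : ℝ} (l : ℕ)
    {F : (Fin l → Z) → ℝ} (hF : LipschitzWith K F) (F0 : ∀ z, 0 ≤ F z) (FM : ∀ z, F z ≤ M) :
    ∫ x, F x ∂(Measure.pi fun _ => α)
      ≤ ∫ x, F x ∂(Measure.pi fun _ => β) + l * ((K + M) * ε) := by
  induction l with
  | zero => 
    have : ∀ (γ : Measure Z) [IsProbabilityMeasure γ],
        Measure.pi (fun _ : Fin 0 => γ) = Measure.dirac default := fun γ _ =>
      Measure.pi_of_empty _ _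
    simp [this]
  | succ l ih =>
    have hint : ∀ (γ : Measure Z) [IsProbabilityMeasure γ],
        Integrable F (Measure.pi fun _ => γ) := fun γ _ =>
      Integrable.of_bound hF.continuous.measurable.aestronglyMeasurable M
        (Eventually.of_forall fun x => by rw [Real.norm_of_nonneg (F0 x)]; exact FM x)
    have hcons : ∀ z, LipschitzWith K fun w : Fin l → Z => F (Fin.cons z w) := fun z => by
      refine LipschitzWith.of_dist_le_mul fun w w' => (hF.dist_le_mul _ _).trans ?_
      gcongr
      refine (dist_pi_le_iff dist_nonneg).2 fun i => ?_
      refine Fin.cases ?_ (fun j => ?_) i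
      · simp
      · simpa using dist_le_pi_dist w w' j
    have hcons' : ∀ w, LipschitzWith K fun z => F (Fin.cons z w : Fin (l + 1) → Z) := fun w => by
      refine LipschitzWith.of_dist_le_mul fun z z' => (hF.dist_le_mul _ _).trans ?_
      gcongr
      refine (dist_pi_le_iff dist_nonneg).2 fun i => ?_
      refine Fin.cases ?_ (fun j => ?_) i
      · simp
      · simp
    have hint' : ∀ z, ∀ (γ : Measure Z) [IsProbabilityMeasure γ],
        Integrable (fun w : Fin l → Z => F (Fin.cons z w)) (Measure.pi fun _ => γ) := fun z γ _ =>
      Integrable.of_bound (hcons z).continuous.measurable.aestronglyMeasurable M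
        (Eventually.of_forall fun x => by rw [Real.norm_of_nonneg (F0 _)]; exact FM _)
    let G : Measure Z → Z → ℝ := fun γ z =>
      ∫ w, F (Fin.cons z w) ∂(Measure.pi fun _ : Fin l => γ)
    have hGlip : ∀ (γ : Measure Z) [IsProbabilityMeasure γ], LipschitzWith K (G γ) := fun γ _ => by
      refine LipschitzWith.of_dist_le_mul fun z z' => ?_
      rw [dist_eq_norm, ← integral_sub (hint' z γ) (hint' z' γ)]
      refine (norm_integral_le_of_norm_le_const (C := K * dist z z')
        (Eventually.of_forall fun w => ?_)).trans_eq (by simp)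
      rw [← dist_eq_norm]
      exact (hcons' w).dist_le_mul z z'
    have hG0 : ∀ (γ : Measure Z) z, 0 ≤ G γ z := fun γ z => integral_nonneg fun w => F0 _
    have hGM : ∀ (γ : Measure Z) [IsProbabilityMeasure γ] z, G γ z ≤ M := fun γ _ z =>
      (integral_mono (hint' z γ) (integrable_const M) fun w => FM _).trans_eq (by simp)
    have hGint : ∀ (γ : Measure Z) [IsProbabilityMeasure γ], Integrable (G γ) α := fun γ _ =>
      Integrable.of_bound (hGlip γ).continuous.measurable.aestronglyMeasurable M
        (Eventually.of_forall fun z => by rw [Real.norm_of_nonneg (hG0 γ z)]; exact hGM γ z)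
    rw [integral_pi_succ α l (hint α), integral_pi_succ β l (hint β)]
    calc ∫ z, G α z ∂α ≤ ∫ z, (G β z + l * ((K + M) * ε)) ∂α :=
          integral_mono (hGint α) ((hGint β).add (integrable_const _))
            fun z => ih (hcons z) (fun _ => F0 _) (fun _ => FM _)
      _ = ∫ z, G β z ∂α + l * ((K + M) * ε) := by
          rw [integral_add (hGint β) (integrable_const _)]; simp
      _ ≤ (∫ z, G β z ∂β + (K + M) * ε) + l * ((K + M) * ε) := by
          gcongr
          exact integral_le_add_of_levyProkhorovEDist_lt hε h (hGlip β) (hG0 β) (hGM β)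
      _ = _ := by push_cast; ring

/-! ### Distance matrix laws in a common metric space -/

open Metric in
/-- The Lévy–Prokhorov distance is not decreased by a closed isometric embedding; closedness makes
images of measurable sets measurable, so that they can serve as test sets. -/
theorem levyProkhorovEDist_le_map_of_isometry {S Z : Type*} [MeasurableSpace S] [MetricSpace S]
    [BorelSpace S] [MeasurableSpace Z] [MetricSpace Z] [BorelSpace Z] {i : S → Z}
    (hi : Isometry i) (hS : IsClosed (Set.range i)) (α β : Measure S) :
    levyProkhorovEDist α β ≤ levyProkhorovEDist (α.map i) (β.map i) := by
  have hm : Measurable i := hi.continuous.measurable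
  have he : MeasurableEmbedding i :=
    (show IsClosedEmbedding i from ⟨hi.isEmbedding, hS⟩).measurableEmbedding
  have aux : ∀ (γ γ' : Measure S) (ε : ENNReal) (B : Set S),
      (γ.map i) (i '' B) ≤ (γ'.map i) (thickening ε.toReal (i '' B)) + ε →
      γ B ≤ γ' (thickening ε.toReal B) + ε := fun γ γ' ε B h => by
    rw [he.map_apply, he.map_apply, Set.preimage_image_eq _ hi.injective] at h
    refine h.trans (add_le_add_left (measure_mono fun z hz => ?_) _)
    obtain ⟨_, ⟨b, hb, rfl⟩, hzb⟩ := mem_thickening_iff.1 hz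
    exact mem_thickening_iff.2 ⟨b, hb, by rwa [hi.dist_eq] at hzb⟩
  refine sInf_le_sInf fun ε hε B hB => ?_
  obtain ⟨h1, h2⟩ := hε _ (he.measurableSet_image.2 hB)
  exact ⟨aux _ _ _ _ h1, aux _ _ _ _ h2⟩

open NNReal in
theorem lipschitzWith_distMatrix (Z : Type*) [MetricSpace Z] (l : ℕ) :
    LipschitzWith 2 (distMatrix Z l) := by
  refine LipschitzWith.of_dist_le_mul fun x y => ?_
  refine (dist_pi_le_iff (by positivity)).2 fun i => (dist_pi_le_iff (by positivity)).2 fun j => ?_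
  have h1 := dist_le_pi_dist x y i
  have h2 := dist_le_pi_dist x y j
  have h3 := dist_dist_dist_le (x i) (x j) (y i) (y j)
  simp only [distMatrix, NNReal.coe_ofNat]
  linarith

theorem integral_distMatrixLaw {X : Type*} [MetricSpace X] [TopologicalSpace.SeparableSpace X]
    [MeasurableSpace X] [BorelSpace X] (μ : ProbabilityMeasure X) (l : ℕ)
    {f : (Fin l → Fin l → ℝ) → ℝ} (hf : Continuous f) :
    ∫ m, f m ∂(distMatrixLaw μ l : Measure _)
      = ∫ x, f (distMatrix X l x) ∂(Measure.pi fun _ => (μ : Measure X)) := by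
  rw [distMatrixLaw, ProbabilityMeasure.toMeasure_map,
    integral_map (measurable_distMatrix X l).aemeasurable hf.aestronglyMeasurable]
  rfl

theorem integral_pi_map_isometry {X S : Type*} [MetricSpace X] [MeasurableSpace X]
    [TopologicalSpace.SeparableSpace X] [BorelSpace X] [MetricSpace S] [MeasurableSpace S]
    [SecondCountableTopology S] [BorelSpace S] (μ : Measure X) [IsProbabilityMeasure μ]
    {i : X → S} (hi : Isometry i) (l : ℕ) {f : (Fin l → Fin l → ℝ) → ℝ} (hf : Continuous f) :
    ∫ x, f (distMatrix X l x) ∂(Measure.pi fun _ => μ)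
      = ∫ x, f (distMatrix S l x) ∂(Measure.pi fun _ => μ.map i) := by
  have hm : Measurable i := hi.continuous.measurable
  have : IsProbabilityMeasure (μ.map i) := Measure.isProbabilityMeasure_map hm.aemeasurable
  rw [← Measure.pi_map_pi (fun _ => hm.aemeasurable), integral_map]
  · have h : ∀ x : Fin l → X, distMatrix S l (fun j => i (x j)) = distMatrix X l x := fun x =>
      funext fun a => funext fun b => hi.dist_eq _ _
    simp only [h]
  · exact (measurable_pi_lambda _ fun j => hm.comp (measurable_pi_apply j)).aemeasurable
  · exact (hf.comp (lipschitzWith_distMatrix S l).continuous).measurable.aestronglyMeasurable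

open NNReal in
/-- If `μ` and `ν` are `ε`-close in some common metric space, then integrals of bounded Lipschitz
functions against their distance matrix laws differ by `O(ε)`. -/
theorem integral_distMatrixLaw_le_add {X : Type*} [MetricSpace X] [CompleteSpace X]
    [TopologicalSpace.SeparableSpace X] [MeasurableSpace X] [BorelSpace X]
    (μ : ProbabilityMeasure X) {Y : Type*} [MetricSpace Y] [CompleteSpace Y]
    [TopologicalSpace.SeparableSpace Y] [MeasurableSpace Y] [BorelSpace Y]
    (ν : ProbabilityMeasure Y) {Z : Type*} [MetricSpace Z] [MeasurableSpace Z] [BorelSpace Z]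
    {φ : X → Z} {φ' : Y → Z} (hφ : Isometry φ) (hφ' : Isometry φ') {ε : ℝ} (hε : 0 < ε)
    (h : levyProkhorovEDist ((μ : Measure X).map φ) ((ν : Measure Y).map φ') < ENNReal.ofReal ε)
    (l : ℕ) {f : (Fin l → Fin l → ℝ) → ℝ} {K : ℝ≥0} {M : ℝ} (hf : LipschitzWith K f)
    (f0 : ∀ m, 0 ≤ f m) (fM : ∀ m, f m ≤ M) :
    ∫ m, f m ∂(distMatrixLaw μ l : Measure _)
      ≤ ∫ m, f m ∂(distMatrixLaw ν l : Measure _) + l * ((K * 2 + M) * ε) := by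
  -- `Z` need not be separable, so it is replaced by the closed separable subspace `S`.
  let S : Set Z := Set.range φ ∪ Set.range φ'
  have hS : IsClosed S := hφ.isClosedEmbedding.isClosed_range.union
    hφ'.isClosedEmbedding.isClosed_range
  have : TopologicalSpace.SeparableSpace S :=
    ((TopologicalSpace.isSeparable_range hφ.continuous).union
      (TopologicalSpace.isSeparable_range hφ'.continuous)).separableSpace
  have : SecondCountableTopology S := UniformSpace.secondCountable_of_separable S
  let ψ : X → S := fun x => ⟨φ x, Or.inl ⟨x, rfl⟩⟩
  let ψ' : Y → S := fun y => ⟨φ' y, Or.inr ⟨y, rfl⟩⟩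
  have hψ : Isometry ψ := Isometry.of_dist_eq fun a b => hφ.dist_eq a b
  have hψ' : Isometry ψ' := Isometry.of_dist_eq fun a b => hφ'.dist_eq a b
  have hm := hψ.continuous.measurable
  have hm' := hψ'.continuous.measurable
  have hc : Measurable (Subtype.val : S → Z) := measurable_subtype_coe
  have := Measure.isProbabilityMeasure_map (μ := (μ : Measure X)) hm.aemeasurable
  have := Measure.isProbabilityMeasure_map (μ := (ν : Measure Y)) hm'.aemeasurable
  have hlt : levyProkhorovEDist ((μ : Measure X).map ψ) ((ν : Measure Y).map ψ')
      < ENNReal.ofReal ε := by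
    refine (levyProkhorovEDist_le_map_of_isometry (i := (Subtype.val : S → Z)) isometry_subtype_coe
      (by simpa using hS) _ _).trans_lt ?_
    rw [Measure.map_map hc hm, Measure.map_map hc hm']
    exact h
  rw [integral_distMatrixLaw μ l hf.continuous, integral_distMatrixLaw ν l hf.continuous,
    integral_pi_map_isometry _ hψ l hf.continuous, integral_pi_map_isometry _ hψ' l hf.continuous]
  have := integral_pi_le_add_of_levyProkhorovEDist_lt hε hlt l
    (hf.comp (lipschitzWith_distMatrix S l)) (fun _ => f0 _) (fun _ => fM _)
  simpa using this

/-! ### Gromov–Prohorov convergence implies convergence of distance matrix laws -/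

theorem gromovProhorovDist_nonneg {X : Type u} [MetricSpace X] [MeasurableSpace X]
    {X' : Type v} [MetricSpace X'] [MeasurableSpace X']
    (μ : ProbabilityMeasure X) (μ' : ProbabilityMeasure X') : 0 ≤ gromovProhorovDist μ μ' :=
  Real.sInf_nonneg fun _ h => h.1.le

/-- The infimum defining the Gromov–Prohorov distance is not over the empty set, since the disjoint
union of two metric spaces carries a metric extending both; hence it is nearly attained. -/
theorem exists_levyProkhorovDist_lt_of_gromovProhorovDist_lt
    {X : Type u} [MetricSpace X] [MeasurableSpace X]
    {X' : Type v} [MetricSpace X'] [MeasurableSpace X']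
    (μ : ProbabilityMeasure X) (μ' : ProbabilityMeasure X') {r : ℝ}
    (h : gromovProhorovDist μ μ' < r) :
    ∃ (Z : Type (max u v)) (_ : MetricSpace Z) (_ : MeasurableSpace Z) (_ : BorelSpace Z)
      (φ : X → Z) (φ' : X' → Z), Isometry φ ∧ Isometry φ' ∧
        levyProkhorovDist ((μ : Measure X).map φ) ((μ' : Measure X').map φ') < r := by
  have hne : {ε : ℝ | 0 < ε ∧
      ∃ (Z : Type (max u v)) (_ : MetricSpace Z) (_ : MeasurableSpace Z) (_ : BorelSpace Z)
      (φ : X → Z) (φ' : X' → Z), Isometry φ ∧ Isometry φ' ∧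
        levyProkhorovDist ((μ : Measure X).map φ) ((μ' : Measure X').map φ') ≤ ε}.Nonempty := by
    let m : MetricSpace (X ⊕ X') := Metric.metricSpaceSum
    let b : MeasurableSpace (X ⊕ X') := borel _
    refine ⟨_ + 1, ?_, X ⊕ X', m, b, ⟨rfl⟩, Sum.inl, Sum.inr, Metric.isometry_inl,
      Metric.isometry_inr, (lt_add_one _).le⟩
    exact add_pos_of_nonneg_of_pos ENNReal.toReal_nonneg one_pos
  obtain ⟨ε, ⟨_, Z, m, b, hb, φ, φ', h1, h2, h3⟩, hε⟩ := exists_lt_of_csInf_lt hne h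
  exact ⟨Z, m, b, hb, φ, φ', h1, h2, h3.trans_lt hε⟩

theorem gromovTendsto_of_tendsto_gromovProhorovDist
    {X : ℕ → Type u} [∀ n, MetricSpace (X n)] [∀ n, CompleteSpace (X n)]
    [∀ n, TopologicalSpace.SeparableSpace (X n)]
    [∀ n, MeasurableSpace (X n)] [∀ n, BorelSpace (X n)]
    {μ : ∀ n, ProbabilityMeasure (X n)}
    {Y : Type v} [MetricSpace Y] [CompleteSpace Y] [TopologicalSpace.SeparableSpace Y]
    [MeasurableSpace Y] [BorelSpace Y] {ν : ProbabilityMeasure Y}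
    (h : Tendsto (fun n => gromovProhorovDist (μ n) ν) atTop (𝓝 0)) : GromovTendsto μ ν := by
  intro l _
  refine tendsto_iff_forall_lipschitz_integral_tendsto.2 ?_
  rintro f ⟨C, hC⟩ ⟨K, hK⟩
  -- The bounded function `f` is shifted so as to take values in `[0, 2 * C]`.
  let g : (Fin l → Fin l → ℝ) → ℝ := fun m => f m - f 0 + C
  have hg : LipschitzWith K g := LipschitzWith.of_dist_le_mul fun a b => by
    simpa [g, Real.dist_eq] using hK.dist_le_mul a b
  have hb : ∀ m, |f m - f 0| ≤ C := fun m => by simpa [Real.dist_eq] using hC m 0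
  have g0 : ∀ m, 0 ≤ g m := fun m => by have := (abs_le.1 (hb m)).1; simp only [g]; linarith
  have gM : ∀ m, g m ≤ 2 * C := fun m => by have := (abs_le.1 (hb m)).2; simp only [g]; linarith
  have hC0 : 0 ≤ C := (abs_nonneg _).trans (hb 0)
  have hfint : ∀ P : ProbabilityMeasure (Fin l → Fin l → ℝ), Integrable f (P : Measure _) :=
    fun P => Integrable.of_bound hK.continuous.aestronglyMeasurable (C + |f 0|)
      (Eventually.of_forall fun m => by
        have := abs_add_le (f m - f 0) (f 0)
        have := hb m
        simp only [sub_add_cancel] at *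
        rw [Real.norm_eq_abs]; linarith)
  have hgf : ∀ P : ProbabilityMeasure (Fin l → Fin l → ℝ),
      ∫ m, g m ∂(P : Measure _) = ∫ m, f m ∂(P : Measure _) + (C - f 0) := fun P => by
    have : g = fun m => f m + (C - f 0) := funext fun m => by simp only [g]; ring
    rw [this, integral_add (hfint P) (integrable_const _)]; simp
  set A : ℝ := l * (K * 2 + 2 * C) with hA
  have hA0 : 0 ≤ A := by positivity
  rw [Metric.tendsto_atTop]
  intro r hr
  have hr' : 0 < r / (A + 1) := by positivity
  obtain ⟨N, hN⟩ := Metric.tendsto_atTop.1 h _ hr'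
  refine ⟨N, fun n hn => ?_⟩
  have hlt : gromovProhorovDist (μ n) ν < r / (A + 1) := by
    have := hN n hn
    rw [Real.dist_eq, sub_zero] at this
    exact (le_abs_self _).trans_lt this
  obtain ⟨Z, _, _, _, φ, φ', h1, h2, h3⟩ :=
    exists_levyProkhorovDist_lt_of_gromovProhorovDist_lt _ _ hlt
  have := Measure.isProbabilityMeasure_map (μ := (μ n : Measure (X n)))
    h1.continuous.measurable.aemeasurable
  have := Measure.isProbabilityMeasure_map (μ := (ν : Measure Y))
    h2.continuous.measurable.aemeasurable
  have h4 := (ENNReal.lt_ofReal_iff_toReal_lt (levyProkhorovEDist_ne_top _ _)).2 h3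
  have e1 := integral_distMatrixLaw_le_add (μ n) ν h1 h2 hr' h4 l hg g0 gM
  have e2 := integral_distMatrixLaw_le_add ν (μ n) h2 h1 hr'
    (by rwa [levyProkhorovEDist_comm]) l hg g0 gM
  rw [hgf, hgf] at e1 e2
  have e3 : l * ((K * 2 + 2 * C) * (r / (A + 1))) < r := by
    rw [← mul_assoc, ← hA, ← mul_div_assoc, div_lt_iff₀ (by positivity)]
    nlinarith
  rw [Real.dist_eq, abs_lt]
  constructor <;> linarith

/-! ### Covering most of the mass by balls around sample points -/

theorem measurableSet_exists_dist_lt (X : Type*) [MetricSpace X] [SecondCountableTopology X]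
    [MeasurableSpace X] [BorelSpace X] (K : ℕ) (ε : ℝ) :
    MeasurableSet {p : X × (Fin K → X) | ∃ i, dist p.1 (p.2 i) < ε} := by
  rw [Set.ofPred_exists]
  exact MeasurableSet.iUnion fun i => (isOpen_lt
    (continuous_fst.dist ((continuous_apply i).comp continuous_snd))
    continuous_const).measurableSet

/-- The first of `K + 1` sample points plays the role of a test point, the others that of centres
of balls. -/
theorem pi_exists_dist_lt_eq_prod {X : Type*} [MetricSpace X] [SecondCountableTopology X]
    [MeasurableSpace X] [BorelSpace X] (μ : Measure X) [IsProbabilityMeasure μ] (K : ℕ) (ε : ℝ) :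
    (Measure.pi fun _ : Fin (K + 1) => μ) {x | ∃ i : Fin K, dist (x 0) (x i.succ) < ε}
      = (μ.prod (Measure.pi fun _ : Fin K => μ)) {p | ∃ i, dist p.1 (p.2 i) < ε} := by
  have hp := measurePreserving_piFinSuccAbove (fun _ : Fin (K + 1) => μ) 0
  rw [← hp.measure_preimage (measurableSet_exists_dist_lt X K ε).nullMeasurableSet]
  congr 1

open Metric ENNReal in
/-- Among sufficiently many independent points, the first has with high probability another one
within distance `ε`. The probability of failure is `∫ μ (ball z ε)ᶜ ^ K ∂μ`. -/
theorem tendsto_pi_exists_dist_lt {X : Type*} [MetricSpace X] [TopologicalSpace.SeparableSpace X]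
    [MeasurableSpace X] [BorelSpace X] (μ : Measure X) [IsProbabilityMeasure μ] {ε : ℝ}
    (hε : 0 < ε) :
    Tendsto (fun K : ℕ => (Measure.pi fun _ : Fin (K + 1) => μ)
      {x | ∃ i : Fin K, dist (x 0) (x i.succ) < ε}) atTop (𝓝 1) := by
  have : SecondCountableTopology X := UniformSpace.secondCountable_of_separable X
  have hmeas := fun K => (measurableSet_exists_dist_lt X K ε).compl
  have hsec : ∀ (K : ℕ) (z : X), (Measure.pi fun _ : Fin K => μ)
      (Prod.mk z ⁻¹' {p : X × (Fin K → X) | ∃ i, dist p.1 (p.2 i) < ε}ᶜ)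
      = μ (ball z ε)ᶜ ^ K := fun K z => by
    have h : Prod.mk z ⁻¹' {p : X × (Fin K → X) | ∃ i, dist p.1 (p.2 i) < ε}ᶜ
        = Set.univ.pi fun _ => (ball z ε)ᶜ := by
      ext w; simp [dist_comm]
    rw [h, Measure.pi_pi]; simp
  have hcompl : ∀ K : ℕ, (Measure.pi fun _ : Fin (K + 1) => μ)
      {x | ∃ i : Fin K, dist (x 0) (x i.succ) < ε} = 1 - ∫⁻ z, μ (ball z ε)ᶜ ^ K ∂μ := fun K => by
    rw [pi_exists_dist_lt_eq_prod, ← compl_compl {p : X × (Fin K → X) | _},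
      prob_compl_eq_one_sub (hmeas K), Measure.prod_apply (hmeas K)]
    simp_rw [hsec]
  have hmeas' : ∀ K : ℕ, Measurable fun z => μ (ball z ε)ᶜ ^ K := fun K => by
    simp_rw [← hsec K]
    exact measurable_measure_prodMk_left (hmeas K)
  have hlim : Tendsto (fun K : ℕ => ∫⁻ z, μ (ball z ε)ᶜ ^ K ∂μ) atTop (𝓝 0) := by
    have := tendsto_lintegral_of_dominated_convergence (μ := μ) (f := fun _ => 0) (fun _ => 1)
      hmeas' (fun K => Eventually.of_forall fun z => pow_le_one₀ zero_le prob_le_one) (by simp) ?_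
    · simpa using this
    · -- Almost every `z` lies in the support of `μ`, where all balls have positive measure.
      filter_upwards [Measure.support_mem_ae (μ := μ)] with z hz
      refine ENNReal.tendsto_pow_atTop_nhds_zero_of_lt_one ?_
      rw [prob_compl_eq_one_sub measurableSet_ball]
      exact ENNReal.sub_lt_self one_ne_top one_ne_zero
        ((Measure.mem_support_iff_forall z).1 hz _ (ball_mem_nhds z hε)).ne'
  simp_rw [hcompl]
  simpa using ENNReal.Tendsto.sub (tendsto_const_nhds (x := (1 : ℝ≥0∞))) hlim (by simp)

open Metric ENNReal in
/-- An event on distance matrices that forces `μ` to be nearly covered by `K` balls. Its openness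
transfers the covering property, with the same `K`, along Gromov convergence. -/
theorem exists_lt_measure_iUnion_ball {X : Type*} [MetricSpace X]
    [TopologicalSpace.SeparableSpace X] [MeasurableSpace X] [BorelSpace X] (μ : Measure X)
    [IsProbabilityMeasure μ] {ε : ℝ} {K : ℕ} {r : ℝ≥0∞}
    (h : r < (Measure.pi fun _ : Fin (K + 1) => μ)
      {x | ∃ i : Fin K, dist (x 0) (x i.succ) < ε}) :
    ∃ c : Fin K → X, r < μ (⋃ i, ball (c i) ε) := by
  have : SecondCountableTopology X := UniformSpace.secondCountable_of_separable X
  by_contra! hc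
  rw [pi_exists_dist_lt_eq_prod,
    Measure.prod_apply_symm (measurableSet_exists_dist_lt X K ε)] at h
  refine absurd h (not_lt.2 ?_)
  refine (lintegral_mono (g := fun _ => r) fun w => ?_).trans_eq (by simp)
  refine (measure_mono fun z hz => ?_).trans (hc w)
  obtain ⟨i, hi⟩ := hz
  exact Set.mem_iUnion.2 ⟨i, hi⟩

/-! ### Empirical measures -/

open ProbabilityTheory in
theorem uniformOn_univ_real {l : ℕ} (s : Set (Fin l)) :
    (uniformOn (Set.univ : Set (Fin l))).real s = (∑ i, s.indicator (fun _ => (1 : ℝ)) i) / l := by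
  classical
  rw [measureReal_def, uniformOn_univ, Measure.count_apply_finite s s.toFinite]
  simp [Set.indicator_apply, Finset.sum_boole, Set.toFinset_card,
    Fintype.card_subtype]

open ProbabilityTheory in
/-- Chebyshev's inequality for empirical measures, with a bound that depends on neither the space
nor the set. The empirical measure of `x : Fin l → X` is the image of the uniform measure on `Fin l`
under `x`. -/
theorem pi_le_real_sub_uniformOn_real_le {X : Type*} [MeasurableSpace X] (μ : Measure X)
    [IsProbabilityMeasure μ] {l : ℕ} (hl : 0 < l) {U : Set X} (hU : MeasurableSet U) {η : ℝ}
    (hη : 0 < η) :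
    (Measure.pi fun _ : Fin l => μ)
        {x | η ≤ μ.real U - (uniformOn (Set.univ : Set (Fin l))).real (x ⁻¹' U)}
      ≤ ENNReal.ofReal (1 / (4 * l * η ^ 2)) := by
  have hl' : (0 : ℝ) < l := by exact_mod_cast hl
  let g : X → ℝ := U.indicator fun _ => 1
  have hg : Measurable g := measurable_const.indicator hU
  have hg01 : ∀ z, g z ∈ Set.Icc (0 : ℝ) 1 := fun z => by
    by_cases hz : z ∈ U <;> simp [g, hz]
  have hL2 : MemLp g 2 μ := memLp_of_bounded (Eventually.of_forall hg01) hg.aestronglyMeasurable 2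
  let S : (Fin l → X) → ℝ := ∑ i, fun x => g (x i)
  have hSL2 : MemLp S 2 (Measure.pi fun _ => μ) :=
    memLp_finsetSum' _ fun i _ => hL2.comp_measurePreserving (measurePreserving_eval _ i)
  have hvar : Var[S; Measure.pi fun _ => μ] ≤ l / 4 := by
    rw [variance_sum_pi fun _ => hL2]
    have := variance_le_sq_of_bounded (Eventually.of_forall hg01) hg.aemeasurable (μ := μ)
    simp only [Finset.sum_const, Finset.card_univ, Fintype.card_fin, nsmul_eq_mul]
    nlinarith
  have hmean : ∫ x, S x ∂(Measure.pi fun _ => μ) = l * μ.real U := by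
    simp only [S, Finset.sum_apply]
    have hint : ∀ i : Fin l, Integrable (fun x : Fin l → X => g (x i)) (Measure.pi fun _ => μ) :=
      fun i => (hL2.comp_measurePreserving (measurePreserving_eval _ i)).integrable one_le_two
    rw [integral_finsetSum _ fun i _ => hint i]
    have : ∀ i : Fin l, ∫ x, g (x i) ∂(Measure.pi fun _ => μ) = μ.real U := fun i => by
      rw [integral_comp_eval (μ := fun _ : Fin l => μ) hg.aestronglyMeasurable]
      simp [g, integral_indicator hU]
    simp [this]
  have hS : ∀ x, l * (uniformOn (Set.univ : Set (Fin l))).real (x ⁻¹' U) = S x := fun x => by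
    rw [uniformOn_univ_real, mul_div_cancel₀ _ hl'.ne']
    simp only [S, g, Finset.sum_apply]
    rfl
  refine (measure_mono fun x hx => ?_).trans
    ((meas_ge_le_variance_div_sq hSL2 (c := l * η) (by positivity)).trans ?_)
  · have hx' : η ≤ μ.real U - (uniformOn (Set.univ : Set (Fin l))).real (x ⁻¹' U) := hx
    show l * η ≤ |S x - _|
    rw [hmean, ← hS, abs_sub_comm, ← mul_sub]
    exact (mul_le_mul_of_nonneg_left hx' hl'.le).trans (le_abs_self _)
  · refine ENNReal.ofReal_le_ofReal ?_
    calc _ ≤ (l / 4) / (l * η) ^ 2 := by gcongr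
      _ = _ := by field_simp

open ProbabilityTheory Metric ENNReal in
/-- If `K` balls nearly cover `μ`, an empirical measure is close to `μ` as soon as it gives almost
enough mass to each of the `2 ^ K` unions of these balls: a test set `B` is compared with the union
of the balls that meet it. -/
theorem levyProkhorovEDist_map_uniformOn_le {X : Type*} [MetricSpace X] [MeasurableSpace X]
    [BorelSpace X] (μ : Measure X) [IsProbabilityMeasure μ] {ε : ℝ} (hε : 0 < ε) {K l : ℕ}
    (hl : 0 < l) {c : Fin K → X} (hc : 1 - ENNReal.ofReal ε < μ (⋃ i, ball (c i) ε))
    {x : Fin l → X}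
    (hx : ∀ s : Finset (Fin K), μ.real (⋃ i ∈ s, ball (c i) ε)
      - (uniformOn (Set.univ : Set (Fin l))).real (x ⁻¹' ⋃ i ∈ s, ball (c i) ε) < ε) :
    levyProkhorovEDist μ ((uniformOn (Set.univ : Set (Fin l))).map x)
      ≤ ENNReal.ofReal (2 * ε) := by
  classical
  have : Nonempty (Fin l) := ⟨⟨0, hl⟩⟩
  have hxm : Measurable x := measurable_from_top
  have := Measure.isProbabilityMeasure_map (μ := uniformOn (Set.univ : Set (Fin l))) hxm.aemeasurable
  refine levyProkhorovEDist_le_of_forall_le _ _ _ fun δ B hδ hδt hB => ?_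
  have hδ' : 2 * ε < δ.toReal := (ENNReal.ofReal_lt_iff_lt_toReal (by positivity) hδt.ne).1 hδ
  let s : Finset (Fin K) := {i | (ball (c i) ε ∩ B).Nonempty}
  let U : Set X := ⋃ i ∈ s, ball (c i) ε
  have hUm : MeasurableSet U := (isOpen_biUnion fun _ _ => isOpen_ball).measurableSet
  have hUB : U ⊆ thickening δ.toReal B := fun z hz => by
    obtain ⟨i, hi, hz⟩ := Set.mem_iUnion₂.1 hz
    obtain ⟨b, hb, hbB⟩ := (Finset.mem_filter.1 hi).2
    refine mem_thickening_iff.2 ⟨b, hbB, ?_⟩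
    have := dist_triangle_right z b (c i)
    rw [mem_ball] at hz hb
    linarith
  have hBU : B ⊆ U ∪ (⋃ i, ball (c i) ε)ᶜ := fun b hb => by
    by_cases h : b ∈ ⋃ i, ball (c i) ε
    · obtain ⟨i, hi⟩ := Set.mem_iUnion.1 h
      exact Or.inl (Set.mem_iUnion₂.2 ⟨i, Finset.mem_filter.2 ⟨Finset.mem_univ _, b, hi, hb⟩, hi⟩)
    · exact Or.inr h
  have hcm : MeasurableSet (⋃ i, ball (c i) ε) := (isOpen_iUnion fun _ => isOpen_ball).measurableSet
  have hrest : μ (⋃ i, ball (c i) ε)ᶜ ≤ ENNReal.ofReal ε := by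
    rw [prob_compl_eq_one_sub hcm, tsub_le_iff_left]
    exact (tsub_le_iff_right.1 hc.le)
  have hU : μ U ≤ (uniformOn (Set.univ : Set (Fin l))).map x U + ENNReal.ofReal ε := by
    have h := (sub_lt_iff_lt_add.1 (hx s)).le
    rw [Measure.map_apply hxm hUm, ← ofReal_measureReal (measure_ne_top μ U),
      ← ofReal_measureReal (measure_ne_top _ (x ⁻¹' U)),
      ← ENNReal.ofReal_add measureReal_nonneg hε.le]
    exact ENNReal.ofReal_le_ofReal (by rwa [add_comm] at h)
  calc μ B ≤ μ U + μ (⋃ i, ball (c i) ε)ᶜ := (measure_mono hBU).trans (measure_union_le _ _)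
    _ ≤ ((uniformOn (Set.univ : Set (Fin l))).map x U + ENNReal.ofReal ε) + ENNReal.ofReal ε :=
        add_le_add hU hrest
    _ = (uniformOn (Set.univ : Set (Fin l))).map x U + ENNReal.ofReal (2 * ε) := by
        rw [add_assoc, ← ENNReal.ofReal_add hε.le hε.le, two_mul]
    _ ≤ _ := add_le_add (measure_mono hUB) hδ.le

open ProbabilityTheory ENNReal in
/-- Empirical measures of `l` points approximate `μ` with probability at least `3 / 4`, where the
required `l` depends only on `ε` and on the number of balls that nearly cover `μ`. -/
theorem pi_levyProkhorovEDist_map_uniformOn_gt_le {X : Type*} [MetricSpace X]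
    [TopologicalSpace.SeparableSpace X] [MeasurableSpace X] [BorelSpace X] (μ : Measure X)
    [IsProbabilityMeasure μ] {ε : ℝ} (hε : 0 < ε) {K l : ℕ} (hl : (2 : ℝ) ^ K ≤ l * ε ^ 2)
    (h : 1 - ENNReal.ofReal ε < (Measure.pi fun _ : Fin (K + 1) => μ)
      {x | ∃ i : Fin K, dist (x 0) (x i.succ) < ε}) :
    (Measure.pi fun _ : Fin l => μ) {x | ENNReal.ofReal (2 * ε) <
      levyProkhorovEDist μ ((uniformOn (Set.univ : Set (Fin l))).map x)} ≤ 4⁻¹ := by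
  have hl0 : 0 < l := by
    rcases Nat.eq_zero_or_pos l with rfl | h0
    · have : (0 : ℝ) < 2 ^ K := by positivity
      simp at hl
      linarith
    · exact h0
  have hl' : (0 : ℝ) < l := by exact_mod_cast hl0
  obtain ⟨c, hc⟩ := exists_lt_measure_iUnion_ball μ h
  let U : Finset (Fin K) → Set X := fun s => ⋃ i ∈ s, Metric.ball (c i) ε
  have hU : ∀ s, MeasurableSet (U s) := fun s =>
    (isOpen_biUnion fun _ _ => Metric.isOpen_ball).measurableSet
  calc _ ≤ (Measure.pi fun _ : Fin l => μ) (⋃ s, {x | ε ≤ μ.real (U s)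
          - (uniformOn (Set.univ : Set (Fin l))).real (x ⁻¹' U s)}) := by
        refine measure_mono fun x hx => ?_
        by_contra hcon
        simp only [Set.mem_iUnion, Set.mem_ofPred_eq, not_exists, not_le] at hcon
        exact absurd (levyProkhorovEDist_map_uniformOn_le μ hε hl0 hc hcon) (not_le.2 hx)
    _ ≤ ∑ s : Finset (Fin K), ENNReal.ofReal (1 / (4 * l * ε ^ 2)) :=
        (measure_iUnion_fintype_le _ _).trans (Finset.sum_le_sum fun s _ =>
          pi_le_real_sub_uniformOn_real_le μ hl0 (hU s) hε)
    _ = ENNReal.ofReal (2 ^ K * (1 / (4 * l * ε ^ 2))) := by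
        rw [Finset.sum_const, Finset.card_univ, Fintype.card_finset, Fintype.card_fin,
          nsmul_eq_mul, ENNReal.ofReal_mul (by positivity)]
        congr 1
        rw [ENNReal.ofReal_pow (by norm_num)]
        simp
    _ ≤ ENNReal.ofReal 4⁻¹ := by
        refine ENNReal.ofReal_le_ofReal ?_
        rw [mul_one_div, div_le_iff₀ (by positivity)]
        linarith
    _ = 4⁻¹ := by rw [ENNReal.ofReal_inv_of_pos (by norm_num)]; simp

/-! ### Gluing along samples -/

open Metric in
theorem levyProkhorovEDist_map_le_of_isometry {X Z : Type*} [MeasurableSpace X] [MetricSpace X]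
    [BorelSpace X] [MeasurableSpace Z] [MetricSpace Z] [BorelSpace Z] {φ : X → Z}
    (hφ : Isometry φ) (α β : Measure X) :
    levyProkhorovEDist (α.map φ) (β.map φ) ≤ levyProkhorovEDist α β := by
  have hm : Measurable φ := hφ.continuous.measurable
  have aux : ∀ (γ γ' : Measure X) (ε : ENNReal) (B : Set Z), MeasurableSet B →
      γ (φ ⁻¹' B) ≤ γ' (thickening ε.toReal (φ ⁻¹' B)) + ε →
      γ.map φ B ≤ γ'.map φ (thickening ε.toReal B) + ε := fun γ γ' ε B hB h => by
    rw [Measure.map_apply hm hB, Measure.map_apply hm isOpen_thickening.measurableSet]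
    refine h.trans (add_le_add_left (measure_mono fun z hz => ?_) _)
    obtain ⟨b, hb, hzb⟩ := mem_thickening_iff.1 hz
    exact mem_thickening_iff.2 ⟨φ b, hb, by rwa [hφ.dist_eq]⟩
  refine sInf_le_sInf fun ε hε B hB => ?_
  obtain ⟨h1, h2⟩ := hε _ (hm hB)
  exact ⟨aux _ _ _ _ hB h1, aux _ _ _ _ hB h2⟩

open Metric in
theorem levyProkhorovEDist_map_map_le_of_dist_le {ι Z : Type*} [MeasurableSpace ι]
    [MeasurableSpace Z] [MetricSpace Z] [BorelSpace Z] (κ : Measure ι) [IsProbabilityMeasure κ]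
    {f g : ι → Z} (hf : Measurable f) (hg : Measurable g) {δ : ℝ} (hδ : 0 ≤ δ)
    (h : ∀ i, dist (f i) (g i) ≤ δ) :
    levyProkhorovEDist (κ.map f) (κ.map g) ≤ ENNReal.ofReal δ := by
  have := Measure.isProbabilityMeasure_map (μ := κ) hf.aemeasurable
  have := Measure.isProbabilityMeasure_map (μ := κ) hg.aemeasurable
  refine levyProkhorovEDist_le_of_forall_le _ _ _ fun ε B hε hεt hB => ?_
  have hε' : δ < ε.toReal := (ENNReal.ofReal_lt_iff_lt_toReal hδ hεt.ne).1 hε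
  rw [Measure.map_apply hf hB, Measure.map_apply hg isOpen_thickening.measurableSet]
  refine (measure_mono fun i hi => ?_).trans le_self_add
  exact mem_thickening_iff.2 ⟨f i, hi, by rw [dist_comm]; exact (h i).trans_lt hε'⟩

/-- Two families of points with nearly equal mutual distances can be superposed, up to `δ`, by
gluing the ambient spaces along them. -/
theorem exists_isometry_dist_le {X : Type u} {Y : Type v} [MetricSpace X] [MetricSpace Y]
    {ι : Type*} [Nonempty ι] {x : ι → X} {y : ι → Y} {δ : ℝ} (hδ : 0 < δ)
    (h : ∀ i j, |dist (x i) (x j) - dist (y i) (y j)| ≤ 2 * δ) :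
    ∃ (Z : Type (max u v)) (_ : MetricSpace Z) (_ : MeasurableSpace Z) (_ : BorelSpace Z)
      (φ : X → Z) (φ' : Y → Z), Isometry φ ∧ Isometry φ' ∧
        ∀ i, dist (φ (x i)) (φ' (y i)) ≤ δ := by
  let m : MetricSpace (X ⊕ Y) := Metric.glueMetricApprox x y δ hδ h
  let b : MeasurableSpace (X ⊕ Y) := borel _
  exact ⟨X ⊕ Y, m, b, ⟨rfl⟩, Sum.inl, Sum.inr, Isometry.of_dist_eq fun _ _ => rfl,
    Isometry.of_dist_eq fun _ _ => rfl, fun i => (Metric.glueDist_glued_points x y δ i).le⟩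

theorem gromovProhorovDist_le {X : Type u} [MetricSpace X] [MeasurableSpace X]
    {X' : Type v} [MetricSpace X'] [MeasurableSpace X']
    (μ : ProbabilityMeasure X) (μ' : ProbabilityMeasure X') {r : ℝ} (hr : 0 < r)
    {Z : Type (max u v)} [MetricSpace Z] [MeasurableSpace Z] [BorelSpace Z]
    {φ : X → Z} {φ' : X' → Z} (hφ : Isometry φ) (hφ' : Isometry φ')
    (h : levyProkhorovEDist ((μ : Measure X).map φ) ((μ' : Measure X').map φ')
      ≤ ENNReal.ofReal r) : gromovProhorovDist μ μ' ≤ r :=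
  csInf_le ⟨0, fun _ h => h.1.le⟩ ⟨hr, Z, _, _, inferInstance, φ, φ', hφ, hφ',
    ENNReal.toReal_le_of_le_ofReal hr.le h⟩

open ProbabilityTheory in
/-- Well-distributed samples with nearly equal distance matrices bound the Gromov–Prohorov
distance. -/
theorem gromovProhorovDist_le_of_samples {X : Type u} [MetricSpace X] [MeasurableSpace X]
    [BorelSpace X] {Y : Type v} [MetricSpace Y] [MeasurableSpace Y] [BorelSpace Y]
    (μ : ProbabilityMeasure X) (ν : ProbabilityMeasure Y) {ε : ℝ} (hε : 0 < ε) {l : ℕ}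
    (hl : 0 < l) {x : Fin l → X} {y : Fin l → Y}
    (hx : levyProkhorovEDist (μ : Measure X) ((uniformOn (Set.univ : Set (Fin l))).map x)
      ≤ ENNReal.ofReal (2 * ε))
    (hy : levyProkhorovEDist (ν : Measure Y) ((uniformOn (Set.univ : Set (Fin l))).map y)
      ≤ ENNReal.ofReal (2 * ε))
    (hxy : dist (distMatrix X l x) (distMatrix Y l y) ≤ 2 * ε) :
    gromovProhorovDist μ ν ≤ 5 * ε := by
  have : Nonempty (Fin l) := ⟨⟨0, hl⟩⟩
  obtain ⟨Z, _, _, _, φ, φ', hφ, hφ', hd⟩ := exists_isometry_dist_le (x := x) (y := y) hε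
    fun i j => ((dist_le_pi_dist (distMatrix X l x i) (distMatrix Y l y i) j).trans
      (dist_le_pi_dist (distMatrix X l x) (distMatrix Y l y) i)).trans hxy
  refine gromovProhorovDist_le μ ν (by positivity) hφ hφ' ?_
  set κ := uniformOn (Set.univ : Set (Fin l))
  have h1 := (levyProkhorovEDist_map_le_of_isometry hφ _ _).trans hx
  have h2 := (levyProkhorovEDist_map_le_of_isometry hφ' _ _).trans hy
  rw [Measure.map_map hφ.continuous.measurable measurable_from_top] at h1
  rw [Measure.map_map hφ'.continuous.measurable measurable_from_top, levyProkhorovEDist_comm] at h2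
  have h3 : levyProkhorovEDist (κ.map (φ ∘ x)) (κ.map (φ' ∘ y)) ≤ ENNReal.ofReal ε :=
    levyProkhorovEDist_map_map_le_of_dist_le κ measurable_from_top measurable_from_top hε.le hd
  calc _ ≤ ENNReal.ofReal (2 * ε) + (ENNReal.ofReal ε + ENNReal.ofReal (2 * ε)) :=
        (levyProkhorovEDist_triangle _ (κ.map (φ ∘ x)) _).trans (add_le_add h1
          ((levyProkhorovEDist_triangle _ (κ.map (φ' ∘ y)) _).trans (add_le_add h3 h2)))
    _ = ENNReal.ofReal (5 * ε) := by
        rw [← ENNReal.ofReal_add (by positivity) (by positivity),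
          ← ENNReal.ofReal_add (by positivity) (by positivity)]
        congr 1; ring

/-! ### Convergence of distance matrix laws implies Gromov–Prohorov convergence -/

theorem distMatrixLaw_apply {X : Type*} [MetricSpace X] [TopologicalSpace.SeparableSpace X]
    [MeasurableSpace X] [BorelSpace X] (μ : ProbabilityMeasure X) (l : ℕ)
    {O : Set (Fin l → Fin l → ℝ)} (hO : IsOpen O) :
    (distMatrixLaw μ l : Measure _) O
      = (Measure.pi fun _ => (μ : Measure X)) (distMatrix X l ⁻¹' O) := by
  rw [distMatrixLaw, ProbabilityMeasure.toMeasure_map,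
    Measure.map_apply (measurable_distMatrix X l) hO.measurableSet]
  rfl

open ENNReal in
/-- The open-set half of the portmanteau theorem for distance matrices. -/
theorem GromovTendsto.eventually_lt {X : ℕ → Type u} [∀ n, MetricSpace (X n)]
    [∀ n, TopologicalSpace.SeparableSpace (X n)]
    [∀ n, MeasurableSpace (X n)] [∀ n, BorelSpace (X n)] {μ : ∀ n, ProbabilityMeasure (X n)}
    {Y : Type v} [MetricSpace Y] [TopologicalSpace.SeparableSpace Y]
    [MeasurableSpace Y] [BorelSpace Y] {ν : ProbabilityMeasure Y} (h : GromovTendsto μ ν)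
    {l : ℕ} (hl : 1 ≤ l) {O : Set (Fin l → Fin l → ℝ)} (hO : IsOpen O) {r : ℝ≥0∞}
    (hr : r < (Measure.pi fun _ => (ν : Measure Y)) (distMatrix Y l ⁻¹' O)) :
    ∀ᶠ n in atTop,
      r < (Measure.pi fun _ => (μ n : Measure (X n))) (distMatrix (X n) l ⁻¹' O) := by
  rw [← distMatrixLaw_apply ν l hO] at hr
  have := eventually_lt_of_lt_liminf
    (hr.trans_le (ProbabilityMeasure.le_liminf_measure_open_of_tendsto (h l hl) hO))
  filter_upwards [this] with n hn
  rwa [← distMatrixLaw_apply (μ n) l hO]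

open ProbabilityTheory ENNReal in
theorem tendsto_gromovProhorovDist_of_gromovTendsto
    {X : ℕ → Type u} [∀ n, MetricSpace (X n)] [∀ n, TopologicalSpace.SeparableSpace (X n)]
    [∀ n, MeasurableSpace (X n)] [∀ n, BorelSpace (X n)] {μ : ∀ n, ProbabilityMeasure (X n)}
    {Y : Type v} [MetricSpace Y] [TopologicalSpace.SeparableSpace Y]
    [MeasurableSpace Y] [BorelSpace Y] {ν : ProbabilityMeasure Y} (h : GromovTendsto μ ν) :
    Tendsto (fun n => gromovProhorovDist (μ n) ν) atTop (𝓝 0) := by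
  suffices H : ∀ ε : ℝ, 0 < ε → ∀ᶠ n in atTop, gromovProhorovDist (μ n) ν ≤ 5 * ε by
    rw [Metric.tendsto_nhds]
    intro r hr
    filter_upwards [H (r / 10) (by positivity)] with n hn
    rw [Real.dist_eq, sub_zero, abs_of_nonneg (gromovProhorovDist_nonneg _ _)]
    linarith
  intro ε hε
  obtain ⟨K, hK⟩ := ((tendsto_pi_exists_dist_lt (ν : Measure Y) hε).eventually_const_lt
    (ENNReal.sub_lt_self one_ne_top one_ne_zero (ENNReal.ofReal_pos.2 hε).ne')).exists
  -- One sample size `l` serves `ν` and eventually all `μ n`, as `K` is common to them.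
  obtain ⟨l, hl⟩ := exists_nat_ge ((2 : ℝ) ^ K / ε ^ 2)
  rw [div_le_iff₀ (by positivity)] at hl
  have hl0 : 0 < l := by
    rcases Nat.eq_zero_or_pos l with rfl | h0
    · have : (0 : ℝ) < 2 ^ K := by positivity
      simp at hl
      linarith
    · exact h0
  let E : Set (Fin (K + 1) → Fin (K + 1) → ℝ) := {m | ∃ i : Fin K, m 0 i.succ < ε}
  have hE : IsOpen E := by
    simp only [E, Set.ofPred_exists]
    exact isOpen_iUnion fun i => isOpen_lt
      ((continuous_apply i.succ).comp (continuous_apply 0)) continuous_const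
  -- The well-distributed samples of `ν`, and the matrices close to one of theirs.
  let G : Set (Fin l → Y) := {y | levyProkhorovEDist (ν : Measure Y)
    ((uniformOn (Set.univ : Set (Fin l))).map y) ≤ ENNReal.ofReal (2 * ε)}
  let O : Set (Fin l → Fin l → ℝ) := Metric.thickening (2 * ε) (distMatrix Y l '' G)
  have hbad : (Measure.pi fun _ : Fin l => (ν : Measure Y)) Gᶜ ≤ 4⁻¹ := by
    simpa [G, Set.compl_ofPred] using
      pi_levyProkhorovEDist_map_uniformOn_gt_le (ν : Measure Y) hε hl hK
  have hGO : G ⊆ distMatrix Y l ⁻¹' O := fun y hy =>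
    Metric.self_subset_thickening (by positivity) _ (Set.mem_image_of_mem _ hy)
  -- `G` need not be measurable, so its measure is bounded below by subadditivity.
  have hO : (4⁻¹ : ℝ≥0∞) < (Measure.pi fun _ : Fin l => (ν : Measure Y)) (distMatrix Y l ⁻¹' O) := by
    refine lt_of_lt_of_le ?_ (measure_mono hGO)
    by_contra! hcon
    have h1 : (1 : ℝ≥0∞) ≤ 4⁻¹ + 4⁻¹ := by
      rw [← measure_univ (μ := Measure.pi fun _ : Fin l => (ν : Measure Y)), ← Set.union_compl_self G]
      exact (measure_union_le _ _).trans (add_le_add hcon hbad)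
    have h2 : (1 : ℝ) ≤ 4⁻¹ + 4⁻¹ := by
      have := ENNReal.toReal_mono (by simp) h1
      rwa [ENNReal.toReal_add (by simp) (by simp), ENNReal.toReal_inv, ENNReal.toReal_one,
        ENNReal.toReal_ofNat] at this
    norm_num at h2
  filter_upwards [h.eventually_lt (Nat.le_add_left 1 K) hE (r := 1 - ENNReal.ofReal ε) hK,
    h.eventually_lt hl0 Metric.isOpen_thickening hO] with n hn1 hn2
  have hbad' := pi_levyProkhorovEDist_map_uniformOn_gt_le (μ n : Measure (X n)) hε hl hn1
  -- Matrices in `O` have larger probability than the samples with a poor empirical measure.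
  obtain ⟨x, hxO, hx⟩ : ∃ x ∈ distMatrix (X n) l ⁻¹' O, levyProkhorovEDist (μ n : Measure (X n))
      ((uniformOn (Set.univ : Set (Fin l))).map x) ≤ ENNReal.ofReal (2 * ε) := by
    by_contra! hcon
    exact absurd (hn2.trans_le (measure_mono hcon)) (not_lt.2 hbad')
  obtain ⟨_, ⟨y, hy, rfl⟩, hxy⟩ := Metric.mem_thickening_iff.1 hxO
  exact gromovProhorovDist_le_of_samples (μ n) ν hε hl0 hx hy hxy.le

theorem mainTheorem1
    (X : ℕ → Type u) [∀ n, MetricSpace (X n)] [∀ n, CompleteSpace (X n)]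
    [∀ n, TopologicalSpace.SeparableSpace (X n)]
    [∀ n, MeasurableSpace (X n)] [∀ n, BorelSpace (X n)]
    (μ : ∀ n, ProbabilityMeasure (X n))
    (Y : Type v) [MetricSpace Y] [CompleteSpace Y] [TopologicalSpace.SeparableSpace Y]
    [MeasurableSpace Y] [BorelSpace Y]
    (ν : ProbabilityMeasure Y) :
    GromovTendsto μ ν ↔
      Tendsto (fun n => gromovProhorovDist (μ n) ν) atTop (𝓝 0) :=
  ⟨tendsto_gromovProhorovDist_of_gromovTendsto, gromovTendsto_of_tendsto_gromovProhorovDist⟩
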